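/- Let $M$ be a smooth four-dimensional manifold, $g$ a smooth Lorentzian metric on $M$ of signature $(+,-,-,-)$ and $\phi$ a smooth function on $M$ (a Weyl frame $(M,g,\phi)$). Let $\gamma=e^{-\phi}g$ be the invariant metric and let $\nabla$ be the Weyl connection, with coefficients $$\Gamma^a_{bc}=\{^a_{bc}\}-\tfrac12 g^{ad}\left(g_{db}\phi_{,c}+g_{dc}\phi_{,b}-g_{bc}\phi_{,d}\right),$$ where $\{^a_{bc}\}$ are the Christoffel symbols of $g$. Its curvature and Ricci tensors are taken with the signs $$R^\mu{}_{\lambda\nu\beta}=\partial_\beta\Gamma^\mu_{\lambda\nu}-\partial_\nu\Gamma^\mu_{\lambda\beta}+\Gamma^\rho_{\lambda\nu}\Gamma^\mu_{\rho\beta}-\Gamma^\rho_{\lambda\beta}\Gamma^\mu_{\rho\nu},\qquad R_{\mu\nu}=R^\alpha{}_{\mu\alpha\nu}.$$ On an open set $U\subseteq M$ let $V$ be the smooth tangent field of a congruence of timelike geodesics of $\nabla$, normalized with $\gamma$: $V^\nu\nabla_\nu V^\mu=0$ and $\gamma(V,V)=1$. Raise and lower indices with $\gamma$ and put $\Pi_{\mu\nu}=\gamma_{\mu\nu}-V_\mu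 V_\nu$, $Q_{\mu\nu}=\nabla_\nu V_\mu$, $$\Theta=\Pi^{\mu\nu}Q_{\mu\nu},\quad \sigma_{\mu\nu}=Q_{(\mu\nu)}-\tfrac13\Theta\,\Pi_{\mu\nu},\quad \omega_{\mu\nu}=Q_{[\mu\nu]},\quad \sigma^2=\tfrac12\sigma_{\mu\nu}\sigma^{\mu\nu},\quad \omega^2=\tfrac12\omega_{\mu\nu}\omega^{\mu\nu}.$$ Then, with $\dot\Theta=V^\mu\nabla_\mu\Theta$, on $U$ $$\dot\Theta+\tfrac13\Theta^2+2(\sigma^2-\omega^2)=R_{\mu\nu}V^\mu V^\nu ,$$ and the same equation holds with $\dot\Theta=d\Theta/d\tau$ along every curve $dx^\mu/d\tau=V^\mu$ of the congruence. The equation has the same form as in the Riemannian case: the identical equation holds for any smooth Lorentzian metric $h$ (of the same signature) with its Levi-Civita connection and a unit timelike geodesic congruence; and the Weyl connection of $(M,g,\phi)$ is the Levi-Civita connection of $\gamma$. It is invariant under Weyl transformations: for every smooth function $f$ the frame $(M,e^{f}g,\phi+f)$ has the same invariant metric and the same Weyl connection as $(M,g,\phi)$, the same normalized geodesic congruences,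 and for every field $V$ the same $\Theta$, $\sigma_{\mu\nu}$, $\omega_{\mu\nu}$ and $R_{\mu\nu}$; the Raychaudhuri equation holds in one frame if and only if it holds in the other. -/

import Mathlib

open Bundle Set Filter Topology
open scoped Manifold ContDiff

noncomputable section

/-! ### Weyl frames on a four-dimensional space-time -/

/-- The coordinate space `ℝ⁴`; manifolds below are modelled on it. -/
abbrev Coord : Type := EuclideanSpace ℝ (Fin 4)

/-- A smooth Lorentzian metric of signature `(+,-,-,-)` on the four-dimensional manifold `M`. -/
structure LorentzMetric (M : Type*) [TopologicalSpace M] [ChartedSpace Coord M]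
    [IsManifold (𝓡 4) ∞ M] where
  /-- the bilinear form on each tangent space -/
  toFun : ∀ x : M, TangentSpace (𝓡 4) x →L[ℝ] TangentSpace (𝓡 4) x →L[ℝ] ℝ
  symm : ∀ (x : M) (v w : TangentSpace (𝓡 4) x), toFun x v w = toFun x w v
  signature : ∀ x : M, ∃ b : Module.Basis (Fin 4) ℝ (TangentSpace (𝓡 4) x), ∀ i j : Fin 4,
    toFun x (b i) (b j) = if i = j then (if i = 0 then 1 else -1) else 0
  smooth : ContMDiff (𝓡 4) ((𝓡 4).prod 𝓘(ℝ, Coord →L[ℝ] Coord →L[ℝ] ℝ)) ∞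
    (fun x ↦ TotalSpace.mk' (Coord →L[ℝ] Coord →L[ℝ] ℝ)
      (E := fun x : M ↦ TangentSpace (𝓡 4) x →L[ℝ] TangentSpace (𝓡 4) x →L[ℝ] ℝ) x (toFun x))

/-- The conformally rescaled metric `e^f g`. -/
def LorentzMetric.rescale {M : Type*} [TopologicalSpace M] [ChartedSpace Coord M]
    [IsManifold (𝓡 4) ∞ M] (g : LorentzMetric M) (f : M → ℝ)
    (hf : ContMDiff (𝓡 4) 𝓘(ℝ, ℝ) ∞ f) : LorentzMetric M where
  toFun x := Real.exp (f x) • g.toFun x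
  symm x v w := by simp [g.symm x v w]
  signature x := by
    obtain ⟨b, hb⟩ := g.signature x
    refine ⟨b.isUnitSMul (w := fun _ ↦ Real.exp (-(f x) / 2))
      (fun _ ↦ (Real.exp_ne_zero _).isUnit), fun i j ↦ ?_⟩
    have h : Real.exp (f x) * (Real.exp (-(f x) / 2) * Real.exp (-(f x) / 2)) = 1 := by
      rw [← Real.exp_add, ← Real.exp_add, ← Real.exp_zero]
      congr 1
      ring
    rw [← hb i j]
    simp only [Module.Basis.isUnitSMul_apply, map_smul, smul_apply,
      smul_eq_mul]
    linear_combination (g.toFun x (b i) (b j)) * h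
  smooth := (Real.contDiff_exp.contMDiff.comp hf).smul_section g.smooth

/-- A Weyl frame `(M, g, φ)` of a Weyl integrable space-time; the Weyl one-form is `dφ`. -/
structure WeylFrame (M : Type*) [TopologicalSpace M] [ChartedSpace Coord M]
    [IsManifold (𝓡 4) ∞ M] where
  /-- the metric `g` -/
  metric : LorentzMetric M
  /-- the Weyl scalar field `φ` -/
  scalar : M → ℝ
  scalar_smooth : ContMDiff (𝓡 4) 𝓘(ℝ, ℝ) ∞ scalar

/-- The invariant metric `γ = e^{-φ} g`. -/
def WeylFrame.invariantMetric {M : Type*} [TopologicalSpace M] [ChartedSpace Coord M]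
    [IsManifold (𝓡 4) ∞ M] (F : WeylFrame M) : LorentzMetric M :=
  F.metric.rescale (fun x ↦ -F.scalar x) F.scalar_smooth.neg

/-- The Weyl transformation `(g, φ) ↦ (e^f g, φ + f)`. -/
def WeylFrame.transform {M : Type*} [TopologicalSpace M] [ChartedSpace Coord M]
    [IsManifold (𝓡 4) ∞ M] (F : WeylFrame M) (f : M → ℝ)
    (hf : ContMDiff (𝓡 4) 𝓘(ℝ, ℝ) ∞ f) : WeylFrame M where
  metric := F.metric.rescale f hf
  scalar x := F.scalar x + f x
  scalar_smooth := F.scalar_smooth.add hf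

/-! ### Components in a chart

All components are functions of the coordinates; they are meaningful on the target of the chart. -/

/-- The coordinate vector `∂_μ` of the chart `e` at the point with coordinates `y`. -/
def coordVector {M : Type*} [TopologicalSpace M] [ChartedSpace Coord M]
    (e : OpenPartialHomeomorph M Coord) (μ : Fin 4) (y : Coord) :
    TangentSpace (𝓡 4) (e.symm y) :=
  mfderiv (𝓡 4) (𝓡 4) e.symm y (EuclideanSpace.single μ (1 : ℝ) : Coord)

/-- `g_{μν} = g(∂_μ, ∂_ν)`. -/
def LorentzMetric.comp {M : Type*} [TopologicalSpace M] [ChartedSpace Coord M]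
    [IsManifold (𝓡 4) ∞ M] (g : LorentzMetric M) (e : OpenPartialHomeomorph M Coord)
    (μ ν : Fin 4) (y : Coord) : ℝ :=
  g.toFun (e.symm y) (coordVector e μ y) (coordVector e ν y)

/-- `V^μ`, the components of a vector field. -/
def vectorComp {M : Type*} [TopologicalSpace M] [ChartedSpace Coord M]
    (V : ∀ x : M, TangentSpace (𝓡 4) x) (e : OpenPartialHomeomorph M Coord)
    (μ : Fin 4) (y : Coord) : ℝ :=
  let w : Coord := mfderiv (𝓡 4) (𝓡 4) e (e.symm y) (V (e.symm y))
  w μ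

/-- The partial derivative `∂_μ` of a function of the coordinates. -/
def pd (μ : Fin 4) (F : Coord → ℝ) (y : Coord) : ℝ :=
  fderiv ℝ F y (EuclideanSpace.single μ (1 : ℝ))

/-! ### Tensor calculus in coordinates

Below `g`, `G` and `V` are the components `g_{μν}`, `Γ^a_{bc}` and `V^μ` as functions of the
coordinates. -/

/-- `g^{μν}`, the inverse matrix of `g_{μν}`. -/
def invComp (g : Fin 4 → Fin 4 → Coord → ℝ) (μ ν : Fin 4) (y : Coord) : ℝ :=
  (Matrix.of fun α β ↦ g α β y)⁻¹ μ ν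

/-- Raising both indices of `T_{μν}`: `T^{μν} = g^{μα} g^{νβ} T_{αβ}`. -/
def raise₂ (g T : Fin 4 → Fin 4 → Coord → ℝ) (μ ν : Fin 4) (y : Coord) : ℝ :=
  ∑ α, ∑ β, invComp g μ α y * invComp g ν β y * T α β y

/-- Lowering an index: `V_μ = g_{μν} V^ν`. -/
def lower (g : Fin 4 → Fin 4 → Coord → ℝ) (V : Fin 4 → Coord → ℝ) (μ : Fin 4) (y : Coord) : ℝ :=
  ∑ ν, g μ ν y * V ν y

/-- The Christoffel symbols `{a; b c} = ½ g^{ad} (g_{db,c} + g_{dc,b} - g_{bc,d})`. -/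
def christoffel (g : Fin 4 → Fin 4 → Coord → ℝ) (a b c : Fin 4) (y : Coord) : ℝ :=
  (1 / 2) * ∑ d, invComp g a d y * (pd c (g d b) y + pd b (g d c) y - pd d (g b c) y)

/-- `∇_ν V^μ = ∂_ν V^μ + Γ^μ_{νλ} V^λ`. -/
def covDerivVector (G : Fin 4 → Fin 4 → Fin 4 → Coord → ℝ) (V : Fin 4 → Coord → ℝ)
    (ν μ : Fin 4) (y : Coord) : ℝ :=
  pd ν (V μ) y + ∑ l, G μ ν l y * V l y

/-- `∇_ν W_μ = ∂_ν W_μ - Γ^λ_{νμ} W_λ`. -/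
def covDerivCovector (G : Fin 4 → Fin 4 → Fin 4 → Coord → ℝ) (W : Fin 4 → Coord → ℝ)
    (ν μ : Fin 4) (y : Coord) : ℝ :=
  pd ν (W μ) y - ∑ l, G l ν μ y * W l y

/-- The curvature tensor `R^μ_{λνβ}`, with the sign for which
`(∇_β ∇_ν - ∇_ν ∇_β) V^μ = R^μ_{λνβ} V^λ`. -/
def curvature (G : Fin 4 → Fin 4 → Fin 4 → Coord → ℝ) (μ l ν β : Fin 4) (y : Coord) : ℝ :=
  pd β (G μ l ν) y - pd ν (G μ l β) y
    + ∑ ρ, (G ρ l ν y * G μ ρ β y - G ρ l β y * G μ ρ ν y)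

/-- The Ricci tensor `R_{μν} = R^α_{μαν}`. -/
def ricci (G : Fin 4 → Fin 4 → Fin 4 → Coord → ℝ) (μ ν : Fin 4) (y : Coord) : ℝ :=
  ∑ α, curvature G α μ α ν y

/-- The projection `Π_{μν} = g_{μν} - V_μ V_ν`. -/
def projection (g : Fin 4 → Fin 4 → Coord → ℝ) (V : Fin 4 → Coord → ℝ)
    (μ ν : Fin 4) (y : Coord) : ℝ :=
  g μ ν y - lower g V μ y * lower g V ν y

/-- The deformation tensor `Q_{μν} = ∇_ν V_μ`. -/
def deformation (g : Fin 4 → Fin 4 → Coord → ℝ) (G : Fin 4 → Fin 4 → Fin 4 → Coord → ℝ)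
    (V : Fin 4 → Coord → ℝ) (μ ν : Fin 4) (y : Coord) : ℝ :=
  covDerivCovector G (lower g V) ν μ y

/-- The expansion `Θ = Π^{μν} Q_{μν}`. -/
def expansion (g : Fin 4 → Fin 4 → Coord → ℝ) (G : Fin 4 → Fin 4 → Fin 4 → Coord → ℝ)
    (V : Fin 4 → Coord → ℝ) (y : Coord) : ℝ :=
  ∑ μ, ∑ ν, raise₂ g (projection g V) μ ν y * deformation g G V μ ν y

/-- The shear `σ_{μν} = Q_{(μν)} - ⅓ Θ Π_{μν}`. -/
def shear (g : Fin 4 → Fin 4 → Coord → ℝ) (G : Fin 4 → Fin 4 → Fin 4 → Coord → ℝ)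
    (V : Fin 4 → Coord → ℝ) (μ ν : Fin 4) (y : Coord) : ℝ :=
  (deformation g G V μ ν y + deformation g G V ν μ y) / 2
    - (1 / 3) * expansion g G V y * projection g V μ ν y

/-- The vorticity `ω_{μν} = Q_{[μν]}`. -/
def vorticity (g : Fin 4 → Fin 4 → Coord → ℝ) (G : Fin 4 → Fin 4 → Fin 4 → Coord → ℝ)
    (V : Fin 4 → Coord → ℝ) (μ ν : Fin 4) (y : Coord) : ℝ :=
  (deformation g G V μ ν y - deformation g G V ν μ y) / 2

/-- The squared magnitude `½ T_{μν} T^{μν}`. -/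
def sqMagnitude (g T : Fin 4 → Fin 4 → Coord → ℝ) (y : Coord) : ℝ :=
  (1 / 2) * ∑ μ, ∑ ν, T μ ν y * raise₂ g T μ ν y

/-- The Raychaudhuri scalar `R_{μν} V^μ V^ν`. -/
def raychaudhuriScalar (G : Fin 4 → Fin 4 → Fin 4 → Coord → ℝ) (V : Fin 4 → Coord → ℝ)
    (y : Coord) : ℝ :=
  ∑ μ, ∑ ν, ricci G μ ν y * V μ y * V ν y

/-! ### Connections, congruences and the Raychaudhuri equation on the manifold -/

/-- The coefficients in the chart `e` of the Levi-Civita connection of a Lorentzian metric. -/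
def LorentzMetric.leviCivita {M : Type*} [TopologicalSpace M] [ChartedSpace Coord M]
    [IsManifold (𝓡 4) ∞ M] (g : LorentzMetric M) (e : OpenPartialHomeomorph M Coord) :
    Fin 4 → Fin 4 → Fin 4 → Coord → ℝ :=
  christoffel (g.comp e)

/-- The coefficients in the chart `e` of the Weyl connection of a Weyl frame,
`Γ^a_{bc} = {a; b c} - ½ g^{ad} (g_{db} φ_{,c} + g_{dc} φ_{,b} - g_{bc} φ_{,d})`. -/
def WeylFrame.connection {M : Type*} [TopologicalSpace M] [ChartedSpace Coord M]
    [IsManifold (𝓡 4) ∞ M] (F : WeylFrame M) (e : OpenPartialHomeomorph M Coord)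
    (a b c : Fin 4) (y : Coord) : ℝ :=
  christoffel (F.metric.comp e) a b c y
    - (1 / 2) * ∑ d, invComp (F.metric.comp e) a d y *
        (F.metric.comp e d b y * pd c (F.scalar ∘ e.symm) y
          + F.metric.comp e d c y * pd b (F.scalar ∘ e.symm) y
          - F.metric.comp e b c y * pd d (F.scalar ∘ e.symm) y)

/-- `V` is, on the open set `U`, the tangent field of a smooth congruence of timelike geodesics of
the connection with coefficients `G e` in the chart `e`, normalized with the metric `γ`:
`V` is smooth, `γ(V, V) = 1` and `V^ν ∇_ν V^μ = 0`. -/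
structure IsGeodesicCongruence {M : Type*} [TopologicalSpace M] [ChartedSpace Coord M]
    [IsManifold (𝓡 4) ∞ M] (γ : LorentzMetric M)
    (G : OpenPartialHomeomorph M Coord → Fin 4 → Fin 4 → Fin 4 → Coord → ℝ)
    (U : Set M) (V : ∀ x : M, TangentSpace (𝓡 4) x) : Prop where
  smooth : ContMDiffOn (𝓡 4) (𝓡 4).tangent ∞
    (fun x ↦ (⟨x, V x⟩ : TangentBundle (𝓡 4) M)) U
  normalized : ∀ x ∈ U, γ.toFun x (V x) (V x) = 1
  geodesic : ∀ e ∈ IsManifold.maximalAtlas (𝓡 4) ∞ M, ∀ x ∈ U ∩ e.source, ∀ μ : Fin 4,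
    ∑ ν, vectorComp V e ν (e x) * covDerivVector (G e) (vectorComp V e) ν μ (e x) = 0

/-- The Raychaudhuri equation on `U` for the field `V`, the metric `γ` and the connection `G`.
In every chart the expansion is differentiable,
`V^μ ∂_μ Θ + Θ²/3 + 2 (σ² - ω²) = R_{μν} V^μ V^ν` at every point of `U`, and
`dΘ/dτ + Θ²/3 + 2 (σ² - ω²) = R_{μν} V^μ V^ν` along every curve of the congruence. -/
def SatisfiesRaychaudhuri {M : Type*} [TopologicalSpace M] [ChartedSpace Coord M]
    [IsManifold (𝓡 4) ∞ M] (γ : LorentzMetric M)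
    (G : OpenPartialHomeomorph M Coord → Fin 4 → Fin 4 → Fin 4 → Coord → ℝ)
    (U : Set M) (V : ∀ x : M, TangentSpace (𝓡 4) x) : Prop :=
  ∀ e ∈ IsManifold.maximalAtlas (𝓡 4) ∞ M,
    let g := γ.comp e
    let v := vectorComp V e
    let Θ := expansion g (G e) v
    let sigmaSq := sqMagnitude g (shear g (G e) v)
    let omegaSq := sqMagnitude g (vorticity g (G e) v)
    (∀ x ∈ U ∩ e.source, DifferentiableAt ℝ Θ (e x) ∧
      (∑ μ, v μ (e x) * pd μ Θ (e x)) + (Θ (e x)) ^ 2 / 3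
          + 2 * (sigmaSq (e x) - omegaSq (e x)) = raychaudhuriScalar (G e) v (e x)) ∧
    ∀ (α : ℝ → M) (τ : ℝ), IsMIntegralCurveAt α V τ → α τ ∈ U ∩ e.source →
      ∃ dΘ : ℝ, HasDerivAt (fun t ↦ Θ (e (α t))) dΘ τ ∧
        dΘ + (Θ (e (α τ))) ^ 2 / 3 + 2 * (sigmaSq (e (α τ)) - omegaSq (e (α τ)))
          = raychaudhuriScalar (G e) v (e (α τ))

end

/-! ### Fields, metrics and integral curves read in a chart -/

section Manifold
variable {M : Type*} [TopologicalSpace M] [ChartedSpace Coord M]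
  {e : OpenPartialHomeomorph M Coord}

/-! Differentiating the factor in `γ = e^{-φ} g` produces exactly the Weyl correction to the
Christoffel symbols, so the Weyl connection is the Levi-Civita connection of `γ`
(`WeylFrame.connection_eq_leviCivita`). The metric `γ` does not change under `(g, φ) ↦ (e^f g, φ +
f)`, and everything reduces to the Levi-Civita case.

In that case put `A^μ_ν = ∇_ν V^μ` in a chart. Metric compatibility gives `Q = gA`
(`deformation_eq`). Since `A V = 0` and `γ(V, V) = 1`, linear algebra gives `Θ = tr A` and `Θ²/3 +
2(σ² - ω²) = tr A²` (`projection_identities`, `expansion_shear_vorticity_eq`). It remains to show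
`V(tr A) + tr A² = R_{μν} V^μ V^ν`. Commuting covariant derivatives turns `V^β ∇_β ∇_α V^α` into the
Ricci term plus `V^β ∇_α ∇_β V^α`, and the differentiated geodesic equation makes the latter `-tr
A²`. `raychaudhuri_algebra` carries this out with partial derivatives and connection coefficients.

The equation along curves is then the chain rule (`hasDerivAt_along_curve`). -/

lemma chart_mdifferentiable (he : e ∈ IsManifold.maximalAtlas (𝓡 4) ∞ M) :
    e.MDifferentiable (𝓡 4) (𝓡 4) :=
  ⟨(contMDiffOn_of_mem_maximalAtlas he).mdifferentiableOn (by simp),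
    (contMDiffOn_symm_of_mem_maximalAtlas he).mdifferentiableOn (by simp)⟩

lemma clm_apply_eq_sum {E : Type*} [AddCommGroup E] [Module ℝ E] [TopologicalSpace E]
    (L : Coord →L[ℝ] E) (w : Coord) : L w = ∑ μ, w μ • L (EuclideanSpace.single μ (1 : ℝ)) := by
  conv_lhs => rw [show w = ∑ μ, w μ • EuclideanSpace.single μ (1 : ℝ) by
    ext i; simp [Pi.single_apply]]
  simp only [map_sum, map_smul]

lemma mfderiv_symm_apply_eq_sum (y : Coord) (u : Coord) :
    (mfderiv (𝓡 4) (𝓡 4) e.symm y u : TangentSpace (𝓡 4) (e.symm y)) =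
      ∑ μ, u μ • coordVector e μ y :=
  clm_apply_eq_sum (E := TangentSpace (𝓡 4) (e.symm y)) (mfderiv (𝓡 4) (𝓡 4) e.symm y) u

lemma eq_sum_coordVector (he : e ∈ IsManifold.maximalAtlas (𝓡 4) ∞ M) {y : Coord}
    (hy : y ∈ e.target) (V : ∀ x : M, TangentSpace (𝓡 4) x) :
    V (e.symm y) = ∑ μ, vectorComp V e μ y • coordVector e μ y := by
  have h := (chart_mdifferentiable he).symm_comp_deriv (e.map_target hy)
  rw [e.right_inv hy] at h
  exact (DFunLike.congr_fun h (V (e.symm y))).symm.trans (mfderiv_symm_apply_eq_sum y _)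

lemma IsMIntegralCurveAt.hasDerivAt_coord (he : e ∈ IsManifold.maximalAtlas (𝓡 4) ∞ M)
    {V : ∀ x : M, TangentSpace (𝓡 4) x} {α : ℝ → M} {τ : ℝ} (hα : IsMIntegralCurveAt α V τ)
    (hx : α τ ∈ e.source) :
    HasDerivAt (fun t ↦ e (α t)) (WithLp.toLp 2 fun μ ↦ vectorComp V e μ (e (α τ))) τ := by
  have h1 := hα.self_of_nhds
  have h2 := ((chart_mdifferentiable he).mdifferentiableAt hx).hasMFDerivAt
  have h3 : HasFDerivAt (fun t ↦ e (α t)) (show ℝ →L[ℝ] Coord from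
      (mfderiv (𝓡 4) (𝓡 4) e (α τ)).comp ((1 : ℝ →L[ℝ] ℝ).smulRight (V (α τ)))) τ :=
    (h2.comp τ h1).hasFDerivAt
  have h4 : HasDerivAt (fun t ↦ e (α t))
      (show Coord from mfderiv (𝓡 4) (𝓡 4) e (α τ) ((1 : ℝ) • V (α τ))) τ := h3.hasDerivAt
  convert h4 using 1
  rw [one_smul]
  ext μ
  simp only [vectorComp]
  rw [e.left_inv hx]

/-- Chain rule: this identifies `dΘ/dτ` with `V^μ ∂_μ Θ`, so the curve form of the equation adds
nothing to the pointwise form. -/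
lemma hasDerivAt_along_curve (he : e ∈ IsManifold.maximalAtlas (𝓡 4) ∞ M)
    {V : ∀ x : M, TangentSpace (𝓡 4) x} {α : ℝ → M} {τ : ℝ} (hα : IsMIntegralCurveAt α V τ)
    (hx : α τ ∈ e.source) {f : Coord → ℝ} (hf : DifferentiableAt ℝ f (e (α τ))) :
    HasDerivAt (fun t ↦ f (e (α t))) (∑ μ, vectorComp V e μ (e (α τ)) * pd μ f (e (α τ))) τ := by
  have h := hf.hasFDerivAt.comp_hasDerivAt τ (hα.hasDerivAt_coord he hx)
  rw [clm_apply_eq_sum] at h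
  exact h

variable [IsManifold (𝓡 4) ∞ M]

lemma coordVector_contMDiffOn (he : e ∈ IsManifold.maximalAtlas (𝓡 4) ∞ M) (μ : Fin 4) :
    ContMDiffOn (𝓡 4) (𝓡 4).tangent ∞
      (fun y : Coord ↦ (⟨e.symm y, coordVector e μ y⟩ : TangentBundle (𝓡 4) M)) e.target := by
  have h1 : ContMDiff (𝓡 4) (𝓡 4).tangent ∞
      (fun y : Coord ↦ (⟨y, EuclideanSpace.single μ (1 : ℝ)⟩ : TangentBundle (𝓡 4) Coord)) :=
    contMDiff_vectorSpace_iff_contDiff.2 contDiff_const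
  have h2 := (contMDiffOn_symm_of_mem_maximalAtlas he).contMDiffOn_tangentMapWithin
    (m := ∞) (by simp) e.open_target.uniqueMDiffOn
  refine (h2.comp h1.contMDiffOn (fun y hy ↦ hy)).congr fun y hy ↦ ?_
  simp only [Function.comp, tangentMapWithin, coordVector]
  rw [mfderivWithin_of_isOpen e.open_target hy]

lemma LorentzMetric.comp_contDiffOn (g : LorentzMetric M)
    (he : e ∈ IsManifold.maximalAtlas (𝓡 4) ∞ M) (μ ν : Fin 4) :
    ContDiffOn ℝ ∞ (g.comp e μ ν) e.target := by
  have h := ContMDiffOn.clm_bundle_apply₂ (F₁ := Coord) (F₂ := Coord) (F₃ := ℝ)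
    (E₁ := fun x : M ↦ TangentSpace (𝓡 4) x) (E₂ := fun x : M ↦ TangentSpace (𝓡 4) x)
    (E₃ := Bundle.Trivial M ℝ) (b := e.symm) (ψ := fun y ↦ g.toFun (e.symm y))
    (g.smooth.comp_contMDiffOn (contMDiffOn_symm_of_mem_maximalAtlas he))
    (coordVector_contMDiffOn he μ) (coordVector_contMDiffOn he ν)
  intro y hy
  have := h y hy
  simp only [contMDiffWithinAt_totalSpace] at this
  exact contMDiffWithinAt_iff_contDiffWithinAt.1 this.2

lemma vectorComp_contDiffOn (he : e ∈ IsManifold.maximalAtlas (𝓡 4) ∞ M) {U : Set M}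
    {V : ∀ x : M, TangentSpace (𝓡 4) x}
    (hV : ContMDiffOn (𝓡 4) (𝓡 4).tangent ∞
      (fun x ↦ (⟨x, V x⟩ : TangentBundle (𝓡 4) M)) U) (μ : Fin 4) :
    ContDiffOn ℝ ∞ (vectorComp V e μ) (e.target ∩ e.symm ⁻¹' U) := by
  have h2 := (contMDiffOn_of_mem_maximalAtlas he).contMDiffOn_tangentMapWithin
    (m := ∞) (by simp) e.open_source.uniqueMDiffOn
  have h1 := hV.comp ((contMDiffOn_symm_of_mem_maximalAtlas he).mono
    (inter_subset_left (t := e.symm ⁻¹' U))) (fun y hy ↦ hy.2)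
  have h3 := (contMDiff_snd_tangentBundle_modelSpace Coord (𝓡 4)).comp_contMDiffOn
    (h2.comp h1 (fun y hy ↦ e.map_target hy.1))
  rw [contMDiffOn_iff_contDiffOn] at h3
  have h4 := (EuclideanSpace.proj μ : Coord →L[ℝ] ℝ).contDiff.comp_contDiffOn h3
  refine h4.congr fun y hy ↦ ?_
  simp only [Function.comp, tangentMapWithin, vectorComp]
  rw [mfderivWithin_of_isOpen e.open_source (e.map_target hy.1)]
  rfl

lemma LorentzMetric.apply_eq_sum_comp (g : LorentzMetric M)
    (he : e ∈ IsManifold.maximalAtlas (𝓡 4) ∞ M) {y : Coord} (hy : y ∈ e.target)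
    (V : ∀ x : M, TangentSpace (𝓡 4) x) :
    g.toFun (e.symm y) (V (e.symm y)) (V (e.symm y)) =
      ∑ μ, ∑ ν, g.comp e μ ν y * vectorComp V e μ y * vectorComp V e ν y := by
  rw [eq_sum_coordVector he hy V]
  simp only [map_sum, map_smul, sum_apply, smul_apply, smul_eq_mul, Finset.mul_sum]
  refine Finset.sum_comm.trans
    (Finset.sum_congr rfl fun μ _ ↦ Finset.sum_congr rfl fun ν _ ↦ ?_)
  simp only [LorentzMetric.comp]
  ring

/-- Pairing with an orthonormal basis reads off each coordinate up to sign. The argument for the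
Raychaudhuri equation uses the signature only through this nondegeneracy. -/
lemma LorentzMetric.nondegenerate (g : LorentzMetric M) (x : M) (v : TangentSpace (𝓡 4) x)
    (hv : ∀ w, g.toFun x w v = 0) : v = 0 := by
  obtain ⟨b, hb⟩ := g.signature x
  refine b.ext_elem fun i ↦ ?_
  have h := hv (b i)
  rw [← b.sum_repr v] at h
  simp only [map_sum, map_smul, hb, smul_eq_mul] at h
  rw [Finset.sum_eq_single i (fun j _ hj ↦ by simp [Ne.symm hj]) (by simp)] at h
  simp only [if_true] at h
  rw [map_zero]
  split_ifs at h <;> simpa using h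

/-- A kernel vector of the component matrix would give a tangent vector orthogonal to every `∂_μ`,
hence zero; the differential of the chart is injective on it, so the kernel vector is zero too. -/
lemma LorentzMetric.comp_det_ne_zero (g : LorentzMetric M)
    (he : e ∈ IsManifold.maximalAtlas (𝓡 4) ∞ M) {y : Coord} (hy : y ∈ e.target) :
    (Matrix.of fun α β ↦ g.comp e α β y).det ≠ 0 := by
  intro h
  obtain ⟨c, hc, h0⟩ := Matrix.exists_mulVec_eq_zero_iff.2 h
  set u : Coord := WithLp.toLp 2 c with hu
  set w : TangentSpace (𝓡 4) (e.symm y) := mfderiv (𝓡 4) (𝓡 4) e.symm y u with hw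
  have hw' : w = ∑ μ, c μ • coordVector e μ y := mfderiv_symm_apply_eq_sum y u
  have hc0 : ∀ μ, g.toFun (e.symm y) (coordVector e μ y) w = 0 := fun μ ↦ by
    rw [hw', ← show _ = (0 : ℝ) from congrFun h0 μ]
    simp [Matrix.mulVec, dotProduct, LorentzMetric.comp, mul_comm]
  have hw0 : w = 0 := by
    refine g.nondegenerate _ _ fun z ↦ ?_
    classical
    -- The expansion in coordinate vectors is stated for fields; no smoothness is needed, so `z` is
    -- extended by zero.
    have hz := eq_sum_coordVector he hy (Function.update (fun _ ↦ 0) (e.symm y) z)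
    rw [Function.update_self] at hz
    rw [hz]
    simp [hc0]
  have h2 := (chart_mdifferentiable he).symm.symm_comp_deriv hy
  have h3 := DFunLike.congr_fun h2 u
  refine hc ?_
  have h4 : u = 0 := by
    rw [← show _ = u from h3]
    change mfderiv (𝓡 4) (𝓡 4) e (e.symm y) w = 0
    rw [hw0, map_zero]
  ext i
  exact congrArg (fun z : Coord ↦ z i) h4

lemma WeylFrame.scalar_contDiffOn (F : WeylFrame M)
    (he : e ∈ IsManifold.maximalAtlas (𝓡 4) ∞ M) : ContDiffOn ℝ ∞ (F.scalar ∘ e.symm) e.target :=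
  (F.scalar_smooth.comp_contMDiffOn (contMDiffOn_symm_of_mem_maximalAtlas he)).contDiffOn

end Manifold

/-! ### Linear algebra of the projection and the deformation at one point -/

/-- Raising one index of `P` gives `1 - E`, where `E = V ⊗ V♭` is idempotent of trace one by
normalization; this yields the value `4 - 1 = 3`. The geodesic equation gives `A E = 0`, and
cyclicity of the trace then removes `E` from the contractions with `g A`, so `E A = 0` is never
required. -/
lemma projection_identities {g A : Matrix (Fin 4) (Fin 4) ℝ} {v : Fin 4 → ℝ}
    (hsym : g.transpose = g) (hdet : g.det ≠ 0) (hnorm : v ⬝ᵥ g.mulVec v = 1)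
    (hgeo : A.mulVec v = 0) {P : Matrix (Fin 4) (Fin 4) ℝ}
    (hP : P = g - Matrix.vecMulVec (g.mulVec v) (g.mulVec v)) :
    ((g * A).transpose * (g⁻¹ * P * g⁻¹.transpose)).trace = A.trace ∧
    ((g * A) * (g⁻¹ * P * g⁻¹.transpose)).trace = A.trace ∧
    (P.transpose * (g⁻¹ * P * g⁻¹.transpose)).trace = 3 ∧
    ((g * A).transpose * (g⁻¹ * (g * A).transpose * g⁻¹.transpose)).trace = (A * A).trace := by
  have hu : IsUnit g.det := hdet.isUnit
  have hi : g⁻¹.transpose = g⁻¹ := by rw [Matrix.transpose_nonsing_inv, hsym]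
  have hPs : P.transpose = P := by
    rw [hP, Matrix.transpose_sub, hsym, Matrix.transpose_vecMulVec]
  set E := Matrix.vecMulVec v (g.mulVec v) with hE
  have h1 : g⁻¹ * P = 1 - E := by
    rw [hP, Matrix.mul_sub, Matrix.nonsing_inv_mul g hu, Matrix.mul_vecMulVec,
      Matrix.mulVec_mulVec, Matrix.nonsing_inv_mul g hu, Matrix.one_mulVec]
  have hEE : E * E = E := by
    rw [hE, Matrix.vecMulVec_mul_vecMulVec, dotProduct_comm, hnorm, one_smul]
  have hE1 : E.trace = 1 := by rw [hE, Matrix.trace_vecMulVec, hnorm]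
  have hAE : A * E = 0 := by rw [hE, Matrix.mul_vecMulVec, hgeo, Matrix.zero_vecMulVec]
  have h2 : (g * A * (g⁻¹ * P * g⁻¹.transpose)).trace = A.trace := by
    rw [hi, Matrix.trace_mul_comm, h1, Matrix.mul_assoc, ← Matrix.mul_assoc g⁻¹,
      Matrix.nonsing_inv_mul g hu, Matrix.one_mul, Matrix.sub_mul, Matrix.trace_sub,
      Matrix.trace_mul_comm E, hAE]
    simp
  refine ⟨?_, h2, ?_, ?_⟩
  · rw [← h2, ← Matrix.trace_transpose]
    simp only [Matrix.transpose_mul, Matrix.transpose_transpose, hPs, hi]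
    rw [Matrix.trace_mul_comm]
    simp only [Matrix.mul_assoc]
  · rw [hPs, hi, Matrix.trace_mul_comm, Matrix.mul_assoc, h1]
    simp only [Matrix.sub_mul, Matrix.mul_sub, hEE, Matrix.one_mul, Matrix.mul_one, sub_self,
      sub_zero, Matrix.trace_sub, hE1, Matrix.trace_one, Fintype.card_fin]
    norm_num
  · have hc : ∀ X, g * (g⁻¹ * X) = X := fun X ↦ by
      rw [← Matrix.mul_assoc, Matrix.mul_nonsing_inv g hu, Matrix.one_mul]
    rw [hi, Matrix.transpose_mul, hsym, ← Matrix.trace_transpose (A * A), Matrix.transpose_mul]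
    simp only [Matrix.mul_assoc, Matrix.mul_nonsing_inv g hu, Matrix.mul_one, hc]

/-! ### The divergence of a geodesic field: index algebra -/

section SumPermutations
variable {ι : Type*} [Fintype ι]

lemma sum_swap_outer (f : ι → ι → ι → ℝ) :
    ∑ x, ∑ y, ∑ z, f x y z = ∑ x, ∑ y, ∑ z, f z y x := by
  rw [Finset.sum_comm]
  exact (Finset.sum_congr rfl fun _ _ ↦ Finset.sum_comm).trans Finset.sum_comm

lemma sum_rotate (f : ι → ι → ι → ℝ) :
    ∑ x, ∑ y, ∑ z, f x y z = ∑ x, ∑ y, ∑ z, f y z x :=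
  (Finset.sum_congr rfl fun _ _ ↦ Finset.sum_comm).trans Finset.sum_comm

lemma sum_rotate' (f : ι → ι → ι → ℝ) :
    ∑ x, ∑ y, ∑ z, f x y z = ∑ x, ∑ y, ∑ z, f z x y :=
  (sum_rotate fun x y z ↦ f z x y).symm

lemma sum_rotate_four (f : ι → ι → ι → ι → ℝ) :
    ∑ x, ∑ y, ∑ z, ∑ w, f x y z w = ∑ x, ∑ y, ∑ z, ∑ w, f w x y z := by
  rw [Finset.sum_comm]
  exact Finset.sum_congr rfl fun _ _ ↦ sum_rotate' _

lemma sum_exchange_pairs (f : ι → ι → ι → ι → ℝ) :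
    ∑ x, ∑ y, ∑ z, ∑ w, f x y z w = ∑ x, ∑ y, ∑ z, ∑ w, f z w y x := by
  rw [Finset.sum_congr rfl fun x _ ↦ sum_swap_outer (f x), Finset.sum_comm]
  exact Finset.sum_congr rfl fun _ _ ↦ Finset.sum_comm

end SumPermutations

/-- The contracted Ricci identity at one point. The arrays `dv`, `ddv`, `dG`, `dA` stand for partial
derivatives, with the differentiation index first, and `A ν μ` stands for `∇_ν V^μ`. Only symmetry
of `ddv` and of the lower indices of `G`, the geodesic equation and its derivative enter. -/
lemma raychaudhuri_algebra {v : Fin 4 → ℝ} {dv : Fin 4 → Fin 4 → ℝ}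
    {ddv G : Fin 4 → Fin 4 → Fin 4 → ℝ} {A : Fin 4 → Fin 4 → ℝ}
    {dG : Fin 4 → Fin 4 → Fin 4 → Fin 4 → ℝ} {dA : Fin 4 → Fin 4 → Fin 4 → ℝ}
    (hddv : ∀ β ν μ, ddv β ν μ = ddv ν β μ)
    (hG : ∀ a b c, G a b c = G a c b) (hdG : ∀ d a b c, dG d a b c = dG d a c b)
    (hA : ∀ ν μ, A ν μ = dv ν μ + ∑ l, G μ ν l * v l)
    (hdA : ∀ β ν μ, dA β ν μ = ddv β ν μ + ∑ l, (dG β μ ν l * v l + G μ ν l * dv β l))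
    (hgeo : ∀ μ, ∑ ν, v ν * A ν μ = 0)
    (hdgeo : ∀ β μ, ∑ ν, (dv β ν * A ν μ + v ν * dA β ν μ) = 0) :
    ∑ β, v β * ∑ α, dA β α α + ∑ α, ∑ β, A β α * A α β =
      ∑ μ, ∑ ν, (∑ α, (dG ν α μ α - dG α α μ ν
        + ∑ ρ, (G ρ μ α * G α ρ ν - G ρ μ ν * G α ρ α))) * v μ * v ν := by
  have e0 : ∑ α, ∑ ν, (dv α ν * A ν α + v ν * dA α ν α) = 0 :=
    Finset.sum_eq_zero fun α _ ↦ hdgeo α α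
  have e1 : ∑ l, (∑ α, G α α l) * ∑ ν, v ν * A ν l = 0 :=
    Finset.sum_eq_zero fun l _ ↦ by rw [hgeo l, mul_zero]
  have c1 : ∑ β, v β * ∑ α, dA β α α = ∑ α, ∑ β, v β * dA β α α := by
    simp only [Finset.mul_sum]; exact Finset.sum_comm
  have c2 : ∀ α β, dA β α α - dA α β α = ∑ l, (dG β α α l * v l + G α α l * dv β l) -
      ∑ l, (dG α α β l * v l + G α β l * dv α l) := fun α β ↦ by
    rw [hdA, hdA, hddv]; ring
  -- Subtracting the traced derivative `∂_α (V^ν ∇_ν V^α) = 0` antisymmetrizes the derivative of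
  -- `A`, so the second derivatives of `V` cancel by `c2`.
  have c3 : ∑ β, v β * ∑ α, dA β α α + ∑ α, ∑ β, A β α * A α β =
      ∑ α, ∑ β, v β * (dA β α α - dA α β α) + ∑ α, ∑ β, (A α β - dv α β) * A β α := by
    rw [c1, ← sub_eq_zero, ← e0]
    simp only [← Finset.sum_add_distrib, ← Finset.sum_sub_distrib]
    refine Finset.sum_congr rfl fun α _ ↦ Finset.sum_congr rfl fun β _ ↦ by ring
  have c4 : ∀ α β, A α β - dv α β = ∑ l, G β α l * v l := fun α β ↦ by rw [hA]; ring
  -- Subtracting `Γ^α_{αl} V^ν ∇_ν V^l = 0` cancels the remaining term `Γ^α_{αl} V^ν ∂_ν V^l` and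
  -- supplies the last `ΓΓ` term of the Ricci tensor.
  rw [c3, ← sub_zero (_ + _), ← e1]
  simp only [c2, c4]
  simp only [hA, mul_sub, mul_add, add_mul, sub_mul, Finset.sum_add_distrib,
    Finset.sum_sub_distrib, Finset.sum_mul, Finset.mul_sum]
  -- Bound indices are renamed term by term, so that after `d1` to `d6` matching sums are
  -- syntactically equal.
  rw [sum_swap_outer fun x y i ↦ v y * (dG y x x i * v i),
    sum_swap_outer fun x y i ↦ v y * (G x x i * dv y i),
    sum_rotate' fun x y i ↦ v y * (dG x x y i * v i),
    sum_rotate fun x y i ↦ v y * (G x y i * dv x i),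
    sum_exchange_pairs fun x y z i ↦ G y x i * v i * (G x y z * v z),
    sum_rotate_four fun x y z i ↦ G i i x * (v y * (G x y z * v z))]
  have d1 : ∀ x y i, v y * (dG y i i x * v x) = dG y i x i * v x * v y := fun x y i ↦ by
    rw [hdG y i i x]; ring
  have d2 : ∀ x y i, v y * (G i i x * dv y x) = G i i x * (v y * dv y x) := fun x y i ↦ by ring
  have d3 : ∀ x y i, v x * (dG i i x y * v y) = dG i i x y * v x * v y := fun x y i ↦ by ring
  have d4 : ∀ x y i, v i * (G y i x * dv y x) = G y x i * v i * dv y x := fun x y i ↦ by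
    rw [hG y i x]; ring
  have d5 : ∀ x y z i, G i z x * v x * (G z i y * v y) = G i x z * G z i y * v x * v y :=
    fun x y z i ↦ by rw [hG i z x]; ring
  have d6 : ∀ x y z i, G z z i * (v x * (G i x y * v y)) = G i x y * G z i z * v x * v y :=
    fun x y z i ↦ by rw [hG z z i]; ring
  simp only [d1, d2, d3, d4, d5, d6]
  ring

/-! ### Calculus of partial derivatives -/

section PartialDerivatives
variable {f h : Coord → ℝ} {y : Coord} {O : Set Coord}

lemma pd_congr (hfh : f =ᶠ[𝓝 y] h) (μ : Fin 4) : pd μ f y = pd μ h y := by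
  rw [pd, pd, hfh.fderiv_eq]

lemma pd_add (hf : DifferentiableAt ℝ f y) (hh : DifferentiableAt ℝ h y) (μ : Fin 4) :
    pd μ (fun z ↦ f z + h z) y = pd μ f y + pd μ h y := by
  simp [pd, fderiv_fun_add hf hh]

lemma pd_mul (hf : DifferentiableAt ℝ f y) (hh : DifferentiableAt ℝ h y) (μ : Fin 4) :
    pd μ (fun z ↦ f z * h z) y = pd μ f y * h y + f y * pd μ h y := by
  simp [pd, fderiv_fun_mul hf hh]
  ring

lemma pd_sum {F : Fin 4 → Coord → ℝ} (hF : ∀ i, DifferentiableAt ℝ (F i) y) (μ : Fin 4) :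
    pd μ (fun z ↦ ∑ i, F i z) y = ∑ i, pd μ (F i) y := by
  simp [pd, fderiv_fun_sum fun i _ ↦ hF i]

lemma pd_sum_mul {F H : Fin 4 → Coord → ℝ} (hF : ∀ i, DifferentiableAt ℝ (F i) y)
    (hH : ∀ i, DifferentiableAt ℝ (H i) y) (μ : Fin 4) :
    pd μ (fun z ↦ ∑ i, F i z * H i z) y = ∑ i, (pd μ (F i) y * H i y + F i y * pd μ (H i) y) := by
  rw [pd_sum fun i ↦ (hF i).fun_mul (hH i)]
  exact Finset.sum_congr rfl fun i _ ↦ pd_mul (hF i) (hH i) μ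

lemma pd_const (c : ℝ) (μ : Fin 4) : pd μ (fun _ ↦ c) y = 0 := by simp [pd]

lemma contDiffOn_pd (hO : IsOpen O) (hf : ContDiffOn ℝ ∞ f O) (μ : Fin 4) :
    ContDiffOn ℝ ∞ (pd μ f) O :=
  (hf.fderiv_of_isOpen hO (by simp)).clm_apply contDiffOn_const

lemma ContDiffOn.differentiableAt_of_isOpen (hO : IsOpen O) (hf : ContDiffOn ℝ ∞ f O)
    (hy : y ∈ O) : DifferentiableAt ℝ f y :=
  (hf.contDiffAt (hO.mem_nhds hy)).differentiableAt (by simp)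

lemma pd_pd_comm (hf : ContDiffAt ℝ ∞ f y) (μ ν : Fin 4) :
    pd μ (pd ν f) y = pd ν (pd μ f) y := by
  have hd : DifferentiableAt ℝ (fderiv ℝ f) y :=
    (hf.fderiv_right (m := ∞) (by simp)).differentiableAt (by simp)
  have h : ∀ α β, pd α (pd β f) y = fderiv ℝ (fderiv ℝ f) y (EuclideanSpace.single α 1)
      (EuclideanSpace.single β 1) := fun α β ↦ by
    change fderiv ℝ (fun z ↦ fderiv ℝ f z (EuclideanSpace.single β 1)) y _ = _
    rw [fderiv_clm_apply hd (differentiableAt_const _)]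
    simp
  rw [h, h]
  exact hf.isSymmSndFDerivAt
    (by simpa using (WithTop.coe_le_coe.2 le_top : ((2 : ℕ∞) : WithTop ℕ∞) ≤ ∞)) _ _

end PartialDerivatives

/-! ### Inverse metric, Christoffel symbols and metric compatibility -/

section Metric
variable {g : Fin 4 → Fin 4 → Coord → ℝ} {y : Coord} {O : Set Coord}

lemma contDiffOn_matrix_det {F : Fin 4 → Fin 4 → Coord → ℝ}
    (hF : ∀ μ ν, ContDiffOn ℝ ∞ (F μ ν) O) :
    ContDiffOn ℝ ∞ (fun z ↦ (Matrix.of fun α β ↦ F α β z).det) O := by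
  simp only [Matrix.det_apply, Matrix.of_apply]
  exact ContDiffOn.sum fun σ _ ↦ (contDiffOn_prod fun i _ ↦ hF _ _).const_smul _

/-- Cramer's rule: each entry of the inverse is the quotient of the determinant with row `ν`
replaced by the `μ`-th unit vector and the full determinant, both polynomial in the components. -/
lemma invComp_contDiffOn (hg : ∀ μ ν, ContDiffOn ℝ ∞ (g μ ν) O)
    (hdet : ∀ z ∈ O, (Matrix.of fun α β ↦ g α β z).det ≠ 0) (μ ν : Fin 4) :
    ContDiffOn ℝ ∞ (invComp g μ ν) O := by
  have h1 : ContDiffOn ℝ ∞ (fun z ↦ (Matrix.of fun α β ↦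
      if α = ν then (if β = μ then (1 : ℝ) else 0) else g α β z).det) O := by
    refine contDiffOn_matrix_det (F := fun α β z ↦
      if α = ν then (if β = μ then (1 : ℝ) else 0) else g α β z) fun α β ↦ ?_
    by_cases h : α = ν
    · simpa [h] using contDiffOn_const
    · simpa [h] using hg α β
  refine (((contDiffOn_matrix_det hg).inv hdet).mul h1).congr fun z _ ↦ ?_
  rw [invComp, Matrix.inv_def, Ring.inverse_eq_inv', Matrix.smul_apply, Matrix.adjugate_apply,
    smul_eq_mul]
  congr 2
  ext α β
  by_cases h : α = ν
  · subst h
    simp [Pi.single_apply]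
  · simp [h]

lemma christoffel_contDiffOn (hO : IsOpen O) (hg : ∀ μ ν, ContDiffOn ℝ ∞ (g μ ν) O)
    (hdet : ∀ z ∈ O, (Matrix.of fun α β ↦ g α β z).det ≠ 0) (a b c : Fin 4) :
    ContDiffOn ℝ ∞ (christoffel g a b c) O :=
  contDiffOn_const.mul (ContDiffOn.sum fun d _ ↦ (invComp_contDiffOn hg hdet a d).mul
    (((contDiffOn_pd hO (hg d b) c).add (contDiffOn_pd hO (hg d c) b)).sub
      (contDiffOn_pd hO (hg b c) d)))

lemma christoffel_symm (hsym : ∀ μ ν, g μ ν = g ν μ) (a b c : Fin 4) :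
    christoffel g a b c = christoffel g a c b := by
  funext z
  simp only [christoffel, hsym c b]
  congr 1
  exact Finset.sum_congr rfl fun d _ ↦ by ring

lemma sum_mul_invComp (hdet : (Matrix.of fun α β ↦ g α β y).det ≠ 0) (t : Fin 4 → ℝ) (μ : Fin 4) :
    ∑ a, g μ a y * ∑ d, invComp g a d y * t d = t μ := by
  have h := congrFun (congrArg (fun A ↦ Matrix.mulVec A t)
    (Matrix.mul_nonsing_inv (Matrix.of fun α β ↦ g α β y) hdet.isUnit)) μ
  simp only [← Matrix.mulVec_mulVec, Matrix.one_mulVec] at h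
  exact h

lemma lower_christoffel (hdet : (Matrix.of fun α β ↦ g α β y).det ≠ 0) (a b c : Fin 4) :
    ∑ l, g a l y * christoffel g l b c y =
      (1 / 2) * (pd c (g a b) y + pd b (g a c) y - pd a (g b c) y) := by
  rw [← sum_mul_invComp hdet (fun d ↦ pd c (g d b) y + pd b (g d c) y - pd d (g b c) y) a,
    Finset.mul_sum]
  exact Finset.sum_congr rfl fun l _ ↦ by rw [christoffel]; ring

/-- This is `∇g = 0`: adding the two lowered Christoffel symbols leaves only the derivative of
`g_{μα}`. -/
lemma pd_metric (hsym : ∀ μ ν, g μ ν = g ν μ)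
    (hdet : (Matrix.of fun α β ↦ g α β y).det ≠ 0) (μ α ν : Fin 4) :
    pd ν (g μ α) y = ∑ l, christoffel g l ν μ y * g l α y
      + ∑ l, christoffel g l ν α y * g μ l y := by
  have h1 := lower_christoffel hdet α ν μ
  have h2 := lower_christoffel hdet μ ν α
  rw [hsym μ ν] at h2
  rw [hsym α ν, hsym α μ] at h1
  simp only [mul_comm (christoffel _ _ _ _ _), fun l ↦ hsym l α]
  rw [h1, h2]
  rw [hsym α μ]
  ring

/-- Since `∇g = 0`, lowering an index commutes with `∇`. This is the one place where the kinematics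
depends on the connection being metric. -/
lemma deformation_eq (hsym : ∀ μ ν, g μ ν = g ν μ) (hg : ∀ μ ν, DifferentiableAt ℝ (g μ ν) y)
    (hdet : (Matrix.of fun α β ↦ g α β y).det ≠ 0) {v : Fin 4 → Coord → ℝ}
    (hv : ∀ μ, DifferentiableAt ℝ (v μ) y) (μ ν : Fin 4) :
    deformation g (christoffel g) v μ ν y =
      ∑ α, g μ α y * covDerivVector (christoffel g) v ν α y := by
  have h1 : pd ν (lower g v μ) y = ∑ α, (pd ν (g μ α) y * v α y + g μ α y * pd ν (v α) y) :=
    pd_sum_mul (fun i ↦ hg μ i) hv ν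
  simp only [deformation, covDerivCovector, covDerivVector]
  rw [h1]
  simp only [pd_metric hsym hdet, add_mul, mul_add, Finset.sum_add_distrib, Finset.sum_mul,
    Finset.mul_sum]
  have s1 : ∑ α, ∑ l, christoffel g l ν μ y * g l α y * v α y =
      ∑ l, christoffel g l ν μ y * _root_.lower g v l y := by
    rw [Finset.sum_comm]
    simp only [_root_.lower, Finset.mul_sum, mul_assoc]
  have s2 : ∑ α, ∑ l, christoffel g l ν α y * g μ l y * v α y =
      ∑ α, ∑ l, g μ α y * (christoffel g α ν l y * v l y) := by
    rw [Finset.sum_comm]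
    exact Finset.sum_congr rfl fun i _ ↦ Finset.sum_congr rfl fun j _ ↦ by ring
  rw [s1, s2]
  ring

lemma pd_covDerivVector {G : Fin 4 → Fin 4 → Fin 4 → Coord → ℝ} {v : Fin 4 → Coord → ℝ}
    (hG : ∀ a b c, DifferentiableAt ℝ (G a b c) y) (hv : ∀ μ, ContDiffAt ℝ ∞ (v μ) y)
    (β ν μ : Fin 4) :
    pd β (covDerivVector G v ν μ) y = pd β (pd ν (v μ)) y
      + ∑ l, (pd β (G μ ν l) y * v l y + G μ ν l y * pd β (v l) y) := by
  have h1 : DifferentiableAt ℝ (pd ν (v μ)) y :=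
    (((hv μ).fderiv_right (m := ∞) (by simp)).clm_apply contDiffAt_const).differentiableAt (by simp)
  have h2 : ∀ l, DifferentiableAt ℝ (v l) y := fun l ↦ (hv l).differentiableAt (by simp)
  have h3 : DifferentiableAt ℝ (fun z ↦ ∑ l, G μ ν l z * v l z) y :=
    DifferentiableAt.fun_sum fun l _ ↦ (hG μ ν l).fun_mul (h2 l)
  rw [← pd_sum_mul (fun l ↦ hG μ ν l) h2 β, ← pd_add h1 h3]
  rfl

end Metric

/-! ### The Raychaudhuri equation in coordinates -/

section Coordinates
variable {g : Fin 4 → Fin 4 → Coord → ℝ} {v : Fin 4 → Coord → ℝ} {y : Coord} {O : Set Coord}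

lemma raise₂_eq (T : Fin 4 → Fin 4 → Coord → ℝ) (μ ν : Fin 4) (y : Coord) :
    raise₂ g T μ ν y = ((Matrix.of fun α β ↦ g α β y)⁻¹ * (Matrix.of fun α β ↦ T α β y) *
      ((Matrix.of fun α β ↦ g α β y)⁻¹).transpose) μ ν := by
  simp only [raise₂, Matrix.mul_apply, Matrix.transpose_apply, Finset.sum_mul, Matrix.of_apply]
  rw [Finset.sum_comm]
  exact Finset.sum_congr rfl fun β _ ↦ Finset.sum_congr rfl fun α _ ↦ by
    simp only [invComp]; ring

lemma sum_mul_raise₂ (T S : Fin 4 → Fin 4 → Coord → ℝ) (y : Coord) :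
    ∑ μ, ∑ ν, T μ ν y * raise₂ g S μ ν y =
      ((Matrix.of fun α β ↦ T α β y).transpose * ((Matrix.of fun α β ↦ g α β y)⁻¹ *
        (Matrix.of fun α β ↦ S α β y) * ((Matrix.of fun α β ↦ g α β y)⁻¹).transpose)).trace := by
  simp only [Matrix.trace, Matrix.diag_apply]
  rw [Finset.sum_comm]
  refine Finset.sum_congr rfl fun ν _ ↦ ?_
  rw [Matrix.mul_apply]
  exact Finset.sum_congr rfl fun μ _ ↦ by rw [raise₂_eq]; rfl

/-- The expansion is the divergence `∇_μ V^μ`, and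
`Θ²/3 + 2 (σ² - ω²) = ∇_α V^β ∇_β V^α`. -/
lemma expansion_shear_vorticity_eq {G : Fin 4 → Fin 4 → Fin 4 → Coord → ℝ}
    (hsym : ∀ μ ν, g μ ν = g ν μ)
    (hdet : (Matrix.of fun α β ↦ g α β y).det ≠ 0)
    (hdef : ∀ μ ν, deformation g G v μ ν y = ∑ α, g μ α y * covDerivVector G v ν α y)
    (hnorm : ∑ μ, ∑ ν, g μ ν y * v μ y * v ν y = 1)
    (hgeo : ∀ μ, ∑ ν, v ν y * covDerivVector G v ν μ y = 0) :
    expansion g G v y = ∑ μ, covDerivVector G v μ μ y ∧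
    (expansion g G v y) ^ 2 / 3 +
        2 * (sqMagnitude g (shear g G v) y - sqMagnitude g (vorticity g G v) y) =
      ∑ α, ∑ β, covDerivVector G v β α y * covDerivVector G v α β y := by
  set gm : Matrix (Fin 4) (Fin 4) ℝ := Matrix.of fun α β ↦ g α β y with hgm
  set A : Matrix (Fin 4) (Fin 4) ℝ := Matrix.of fun μ ν ↦ covDerivVector G v ν μ y with hA
  set P : Matrix (Fin 4) (Fin 4) ℝ := Matrix.of fun α β ↦ projection g v α β y with hPdef
  have hlow : gm.mulVec (fun μ ↦ v μ y) = fun μ ↦ _root_.lower g v μ y := rfl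
  have hP : P = gm - Matrix.vecMulVec (gm.mulVec fun μ ↦ v μ y) (gm.mulVec fun μ ↦ v μ y) := by
    ext α β
    rw [hlow]
    rfl
  have hgs : gm.transpose = gm := by
    ext α β
    exact congrFun (hsym β α) y
  have hn : (fun μ ↦ v μ y) ⬝ᵥ gm.mulVec (fun μ ↦ v μ y) = 1 := by
    rw [← hnorm]
    simp only [dotProduct, Matrix.mulVec, Finset.mul_sum, hgm, Matrix.of_apply]
    exact Finset.sum_congr rfl fun β _ ↦ Finset.sum_congr rfl fun α _ ↦ by ring
  have hg0 : A.mulVec (fun μ ↦ v μ y) = 0 := by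
    ext μ
    rw [Pi.zero_apply, ← hgeo μ]
    simp only [Matrix.mulVec, dotProduct, hA, Matrix.of_apply, mul_comm]
  have hQ : (Matrix.of fun α β ↦ deformation g G v α β y) = gm * A := by
    ext μ ν
    rw [Matrix.of_apply, hdef, Matrix.mul_apply]
    rfl
  obtain ⟨h1, h2, h3, h4⟩ := projection_identities hgs hdet hn hg0 hP
  have hΘ : expansion g G v y = A.trace := by
    rw [← h1, ← hQ, hPdef, hgm, ← sum_mul_raise₂]
    exact Finset.sum_congr rfl fun β _ ↦ Finset.sum_congr rfl fun α _ ↦ mul_comm _ _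
  refine ⟨hΘ, ?_⟩
  have hAA : ∑ α, ∑ β, covDerivVector G v β α y * covDerivVector G v α β y = (A * A).trace := rfl
  have hσ : (Matrix.of fun α β ↦ shear g G v α β y) =
      (1 / 2 : ℝ) • (gm * A + (gm * A).transpose) - (1 / 3 * A.trace) • P := by
    ext α β
    rw [← hQ, ← hΘ]
    simp [shear, hPdef]
    ring
  have hω : (Matrix.of fun α β ↦ vorticity g G v α β y) =
      (1 / 2 : ℝ) • (gm * A - (gm * A).transpose) := by
    ext α β
    rw [← hQ]
    simp [vorticity]
    ring
  rw [hAA, hΘ, sqMagnitude, sqMagnitude, sum_mul_raise₂, sum_mul_raise₂, hσ, hω, ← hgm]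
  set Q := gm * A
  set B := gm⁻¹.transpose
  -- The contraction `X_{μν} Y^{μν}` is symmetric. The terms `Q_{μν} Q^{μν}` cancel between `σ²` and
  -- `ω²`, so only `Q_{μν} Q^{νμ} = tr A²` and contractions with `P` remain; the latter add up to
  -- `-Θ²/3`.
  have hswap : ∀ X Y : Matrix (Fin 4) (Fin 4) ℝ,
      (X.transpose * (gm⁻¹ * Y * B)).trace = (Y.transpose * (gm⁻¹ * X * B)).trace := fun X Y ↦ by
    have hi : gm⁻¹.transpose = gm⁻¹ := by rw [Matrix.transpose_nonsing_inv, hgs]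
    rw [← Matrix.trace_transpose]
    simp only [Matrix.transpose_mul, Matrix.transpose_transpose, B, hi]
    rw [Matrix.mul_assoc, Matrix.trace_mul_comm]
    simp only [Matrix.mul_assoc]
  have h5 := hswap P Q
  have h6 := hswap P Q.transpose
  have h7 := hswap Q.transpose Q
  rw [Matrix.transpose_transpose] at h6 h7
  simp only [Matrix.transpose_add, Matrix.transpose_sub, Matrix.transpose_smul,
    Matrix.transpose_transpose, Matrix.add_mul, Matrix.sub_mul, Matrix.mul_add, Matrix.mul_sub,
    Matrix.smul_mul, Matrix.mul_smul, Matrix.trace_add, Matrix.trace_sub, Matrix.trace_smul,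
    smul_eq_mul, h1, h2, h3, h4, h5, h6, h7]
  ring

theorem raychaudhuri_in_coordinates (hO : IsOpen O) (hy : y ∈ O)
    (hsym : ∀ μ ν, g μ ν = g ν μ) (hg : ∀ μ ν, ContDiffOn ℝ ∞ (g μ ν) O)
    (hdet : ∀ z ∈ O, (Matrix.of fun α β ↦ g α β z).det ≠ 0)
    (hv : ∀ μ, ContDiffOn ℝ ∞ (v μ) O)
    (hnorm : ∀ z ∈ O, ∑ μ, ∑ ν, g μ ν z * v μ z * v ν z = 1)
    (hgeo : ∀ z ∈ O, ∀ μ, ∑ ν, v ν z * covDerivVector (christoffel g) v ν μ z = 0) :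
    DifferentiableAt ℝ (expansion g (christoffel g) v) y ∧
    (∑ μ, v μ y * pd μ (expansion g (christoffel g) v) y)
        + (expansion g (christoffel g) v y) ^ 2 / 3
        + 2 * (sqMagnitude g (shear g (christoffel g) v) y
          - sqMagnitude g (vorticity g (christoffel g) v) y) =
      raychaudhuriScalar (christoffel g) v y := by
  have hG := christoffel_contDiffOn hO hg hdet
  have hA : ∀ ν μ, ContDiffOn ℝ ∞ (covDerivVector (christoffel g) v ν μ) O := fun ν μ ↦
    (contDiffOn_pd hO (hv μ) ν).add (ContDiffOn.sum fun l _ ↦ (hG μ ν l).mul (hv l))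
  have hkin : ∀ z ∈ O, _ := fun z hz ↦ expansion_shear_vorticity_eq hsym (hdet z hz)
    (deformation_eq hsym (fun μ ν ↦ (hg μ ν).differentiableAt_of_isOpen hO hz) (hdet z hz)
      fun μ ↦ (hv μ).differentiableAt_of_isOpen hO hz) (hnorm z hz) (hgeo z hz)
  have hAd : ∀ ν μ, DifferentiableAt ℝ (covDerivVector (christoffel g) v ν μ) y :=
    fun ν μ ↦ (hA ν μ).differentiableAt_of_isOpen hO hy
  have hvd : ∀ μ, DifferentiableAt ℝ (v μ) y := fun μ ↦ (hv μ).differentiableAt_of_isOpen hO hy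
  -- The identity with the divergence is needed on a neighbourhood of `y`, since `Θ` is about to be
  -- differentiated.
  have hΘ : expansion g (christoffel g) v =ᶠ[𝓝 y]
      fun z ↦ ∑ μ, covDerivVector (christoffel g) v μ μ z :=
    Filter.eventually_of_mem (hO.mem_nhds hy) fun z hz ↦ (hkin z hz).1
  refine ⟨(DifferentiableAt.fun_sum fun μ _ ↦ hAd μ μ).congr_of_eventuallyEq hΘ, ?_⟩
  rw [add_assoc, (hkin y hy).2]
  simp only [pd_congr hΘ, pd_sum fun μ ↦ hAd μ μ]
  refine raychaudhuri_algebra (dv := fun β μ ↦ pd β (v μ) y)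
    (ddv := fun β ν μ ↦ pd β (pd ν (v μ)) y) (G := fun a b c ↦ christoffel g a b c y)
    (dG := fun d a b c ↦ pd d (christoffel g a b c) y)
    (dA := fun β ν μ ↦ pd β (covDerivVector (christoffel g) v ν μ) y)
    (A := fun ν μ ↦ covDerivVector (christoffel g) v ν μ y) (v := fun μ ↦ v μ y)
    (fun β ν μ ↦ pd_pd_comm ((hv μ).contDiffAt (hO.mem_nhds hy)) β ν)
    (fun a b c ↦ by rw [christoffel_symm hsym]) (fun d a b c ↦ by rw [christoffel_symm hsym])
    (fun ν μ ↦ rfl)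
    (pd_covDerivVector (fun a b c ↦ (hG a b c).differentiableAt_of_isOpen hO hy)
      fun μ ↦ (hv μ).contDiffAt (hO.mem_nhds hy))
    (hgeo y hy) fun β μ ↦ ?_
  -- The geodesic equation holds throughout `O`, so its partial derivatives vanish at `y`.
  rw [← pd_sum_mul hvd (fun ν ↦ hAd ν μ) β, ← pd_const (y := y) 0 β]
  exact pd_congr (Filter.eventually_of_mem (hO.mem_nhds hy) fun z hz ↦ hgeo z hz μ) β

end Coordinates

/-! ### Dependence on the connection coefficients -/

section Congruence
variable {g : Fin 4 → Fin 4 → Coord → ℝ} {v : Fin 4 → Coord → ℝ} {y : Coord}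
  {G G' : Fin 4 → Fin 4 → Fin 4 → Coord → ℝ}

lemma covDerivVector_congr (h : ∀ a b c, G a b c y = G' a b c y) (ν μ : Fin 4) :
    covDerivVector G v ν μ y = covDerivVector G' v ν μ y := by
  simp only [covDerivVector, h]

lemma deformation_congr (h : ∀ a b c, G a b c y = G' a b c y) (μ ν : Fin 4) :
    deformation g G v μ ν y = deformation g G' v μ ν y := by
  simp only [deformation, covDerivCovector, h]

lemma expansion_congr (h : ∀ a b c, G a b c y = G' a b c y) :
    expansion g G v y = expansion g G' v y := by
  simp only [expansion, deformation_congr h]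

lemma shear_congr (h : ∀ a b c, G a b c y = G' a b c y) (μ ν : Fin 4) :
    shear g G v μ ν y = shear g G' v μ ν y := by
  simp only [shear, deformation_congr h, expansion_congr h]

lemma vorticity_congr (h : ∀ a b c, G a b c y = G' a b c y) (μ ν : Fin 4) :
    vorticity g G v μ ν y = vorticity g G' v μ ν y := by
  simp only [vorticity, deformation_congr h]

lemma sqMagnitude_congr {T S : Fin 4 → Fin 4 → Coord → ℝ} (h : ∀ μ ν, T μ ν y = S μ ν y) :
    sqMagnitude g T y = sqMagnitude g S y := by
  simp only [sqMagnitude, raise₂, h]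

lemma eventuallyEq_of_eqOn_isOpen {O : Set Coord} (hO : IsOpen O)
    (h : ∀ y ∈ O, ∀ a b c, G a b c y = G' a b c y) (hy : y ∈ O) (a b c : Fin 4) :
    G a b c =ᶠ[𝓝 y] G' a b c :=
  Filter.eventually_of_mem (hO.mem_nhds hy) fun z hz ↦ h z hz a b c

/-- Curvature differentiates the coefficients, so agreement near `y` is required, whereas agreement
at `y` suffices for the kinematic quantities. -/
lemma ricci_congr (h : ∀ a b c, G a b c =ᶠ[𝓝 y] G' a b c) (μ ν : Fin 4) :
    ricci G μ ν y = ricci G' μ ν y := by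
  simp only [ricci, curvature, fun a b c ↦ (h a b c).eq_of_nhds,
    fun a b c d ↦ pd_congr (h a b c) d]

end Congruence

/-! ### Weyl frames and the passage to the invariant metric -/

section Manifold
variable {M : Type*} [TopologicalSpace M] [ChartedSpace Coord M] [IsManifold (𝓡 4) ∞ M]
  {e : OpenPartialHomeomorph M Coord} {γ : LorentzMetric M}
  {G G' : OpenPartialHomeomorph M Coord → Fin 4 → Fin 4 → Fin 4 → Coord → ℝ}
  {U : Set M} {V : ∀ x : M, TangentSpace (𝓡 4) x}

/-- The equation along the curves of the congruence follows from the pointwise equation. -/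
lemma satisfiesRaychaudhuri_iff :
    SatisfiesRaychaudhuri γ G U V ↔ ∀ e ∈ IsManifold.maximalAtlas (𝓡 4) ∞ M,
      ∀ x ∈ U ∩ e.source,
        DifferentiableAt ℝ (expansion (γ.comp e) (G e) (vectorComp V e)) (e x) ∧
        (∑ μ, vectorComp V e μ (e x) *
            pd μ (expansion (γ.comp e) (G e) (vectorComp V e)) (e x))
          + (expansion (γ.comp e) (G e) (vectorComp V e) (e x)) ^ 2 / 3
          + 2 * (sqMagnitude (γ.comp e) (shear (γ.comp e) (G e) (vectorComp V e)) (e x)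
            - sqMagnitude (γ.comp e) (vorticity (γ.comp e) (G e) (vectorComp V e)) (e x))
        = raychaudhuriScalar (G e) (vectorComp V e) (e x) := by
  refine ⟨fun h e he ↦ (h e he).1, fun h e he ↦ ⟨h e he, fun α τ hα hx ↦ ?_⟩⟩
  obtain ⟨hd, heq⟩ := h e he (α τ) hx
  exact ⟨_, hasDerivAt_along_curve he hα hx.2 hd, heq⟩

lemma SatisfiesRaychaudhuri.congr (h : ∀ e ∈ IsManifold.maximalAtlas (𝓡 4) ∞ M, ∀ y ∈ e.target,
    ∀ a b c, G e a b c y = G' e a b c y) (hG : SatisfiesRaychaudhuri γ G U V) :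
    SatisfiesRaychaudhuri γ G' U V := by
  rw [satisfiesRaychaudhuri_iff] at hG ⊢
  intro e he x hx
  have hy := e.map_source hx.2
  have hΘ : expansion (γ.comp e) (G e) (vectorComp V e) =ᶠ[𝓝 (e x)]
      expansion (γ.comp e) (G' e) (vectorComp V e) :=
    Filter.eventually_of_mem (e.open_target.mem_nhds hy) fun z hz ↦ expansion_congr (h e he z hz)
  obtain ⟨hd, heq⟩ := hG e he x hx
  refine ⟨hd.congr_of_eventuallyEq hΘ.symm, ?_⟩
  have hR : raychaudhuriScalar (G e) (vectorComp V e) (e x) =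
      raychaudhuriScalar (G' e) (vectorComp V e) (e x) := by
    simp only [raychaudhuriScalar, ricci_congr (eventuallyEq_of_eqOn_isOpen e.open_target (h e he) hy)]
  rw [← hR, ← heq, sqMagnitude_congr (shear_congr (h e he _ hy)),
    sqMagnitude_congr (vorticity_congr (h e he _ hy)), hΘ.eq_of_nhds]
  simp only [pd_congr hΘ]

lemma IsGeodesicCongruence.congr (h : ∀ e ∈ IsManifold.maximalAtlas (𝓡 4) ∞ M, ∀ y ∈ e.target,
    ∀ a b c, G e a b c y = G' e a b c y) (hG : IsGeodesicCongruence γ G U V) :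
    IsGeodesicCongruence γ G' U V where
  smooth := hG.smooth
  normalized := hG.normalized
  geodesic e he x hx μ := by
    rw [← hG.geodesic e he x hx μ]
    simp only [covDerivVector_congr (h e he _ (e.map_source hx.2))]

lemma LorentzMetric.comp_symm (g : LorentzMetric M) (e : OpenPartialHomeomorph M Coord)
    (μ ν : Fin 4) : g.comp e μ ν = g.comp e ν μ :=
  funext fun _ ↦ g.symm _ _ _

/-- The Raychaudhuri equation for the Levi-Civita connection of a Lorentzian metric. -/
theorem IsGeodesicCongruence.satisfiesRaychaudhuri {h : LorentzMetric M} (hU : IsOpen U)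
    (hV : IsGeodesicCongruence h h.leviCivita U V) :
    SatisfiesRaychaudhuri h h.leviCivita U V := by
  rw [satisfiesRaychaudhuri_iff]
  intro e he x hx
  have hO : IsOpen (e.target ∩ e.symm ⁻¹' U) := e.isOpen_inter_preimage_symm hU
  have hy : e x ∈ e.target ∩ e.symm ⁻¹' U :=
    ⟨e.map_source hx.2, by rw [mem_preimage, e.left_inv hx.2]; exact hx.1⟩
  refine raychaudhuri_in_coordinates hO hy (h.comp_symm e)
    (fun μ ν ↦ (h.comp_contDiffOn he μ ν).mono inter_subset_left)
    (fun z hz ↦ h.comp_det_ne_zero he hz.1) (vectorComp_contDiffOn he hV.smooth)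
    (fun z hz ↦ ?_) (fun z hz μ ↦ ?_)
  · rw [← h.apply_eq_sum_comp he hz.1 V]
    exact hV.normalized _ hz.2
  · have := hV.geodesic e he (e.symm z) ⟨hz.2, e.map_target hz.1⟩ μ
    rwa [e.right_inv hz.1] at this

lemma WeylFrame.invariantMetric_comp (F : WeylFrame M) (e : OpenPartialHomeomorph M Coord)
    (μ ν : Fin 4) : F.invariantMetric.comp e μ ν =
      fun z ↦ Real.exp (-(F.scalar ∘ e.symm) z) * F.metric.comp e μ ν z :=
  rfl

lemma WeylFrame.invComp_invariantMetric (F : WeylFrame M)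
    (he : e ∈ IsManifold.maximalAtlas (𝓡 4) ∞ M) {y : Coord} (hy : y ∈ e.target) (μ ν : Fin 4) :
    invComp (F.invariantMetric.comp e) μ ν y =
      Real.exp ((F.scalar ∘ e.symm) y) * invComp (F.metric.comp e) μ ν y := by
  have h : (Matrix.of fun α β ↦ F.invariantMetric.comp e α β y) =
      Real.exp (-(F.scalar ∘ e.symm) y) • Matrix.of fun α β ↦ F.metric.comp e α β y := rfl
  rw [invComp, h, Matrix.inv_eq_right_inv
    (B := Real.exp ((F.scalar ∘ e.symm) y) • (Matrix.of fun α β ↦ F.metric.comp e α β y)⁻¹)]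
  · rfl
  · rw [Matrix.smul_mul, Matrix.mul_smul, smul_smul, ← Real.exp_add, neg_add_cancel,
      Real.exp_zero, one_smul, Matrix.mul_nonsing_inv _ (F.metric.comp_det_ne_zero he hy).isUnit]

/-- The Weyl connection is the Levi-Civita connection of the invariant metric. -/
theorem WeylFrame.connection_eq_leviCivita (F : WeylFrame M)
    (he : e ∈ IsManifold.maximalAtlas (𝓡 4) ∞ M) {y : Coord} (hy : y ∈ e.target)
    (a b c : Fin 4) : F.connection e a b c y = F.invariantMetric.leviCivita e a b c y := by
  have hφ : DifferentiableAt ℝ (F.scalar ∘ e.symm) y :=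
    (F.scalar_contDiffOn he).differentiableAt_of_isOpen e.open_target hy
  have hg : ∀ μ ν, DifferentiableAt ℝ (F.metric.comp e μ ν) y := fun μ ν ↦
    (F.metric.comp_contDiffOn he μ ν).differentiableAt_of_isOpen e.open_target hy
  have hexp : ∀ μ, pd μ (fun z ↦ Real.exp (-(F.scalar ∘ e.symm) z)) y =
      -Real.exp (-(F.scalar ∘ e.symm) y) * pd μ (F.scalar ∘ e.symm) y := fun μ ↦ by
    rw [pd, (hφ.hasFDerivAt.fun_neg.exp).fderiv]
    simp [pd]
  -- The terms `-φ_{,d} g_{μν}` assemble into the Weyl correction; the exponential in front cancels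
  -- against the one in the inverse metric by `hone`.
  have hpd : ∀ d μ ν, pd d (F.invariantMetric.comp e μ ν) y = Real.exp (-(F.scalar ∘ e.symm) y) *
      (pd d (F.metric.comp e μ ν) y
        - pd d (F.scalar ∘ e.symm) y * F.metric.comp e μ ν y) := fun d μ ν ↦ by
    rw [F.invariantMetric_comp, pd_mul hφ.fun_neg.exp (hg μ ν), hexp]
    ring
  have hone : Real.exp ((F.scalar ∘ e.symm) y) * Real.exp (-(F.scalar ∘ e.symm) y) = 1 := by
    rw [← Real.exp_add, add_neg_cancel, Real.exp_zero]
  rw [WeylFrame.connection, LorentzMetric.leviCivita, christoffel, christoffel, ← mul_sub,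
    ← Finset.sum_sub_distrib]
  congr 1
  refine Finset.sum_congr rfl fun d _ ↦ ?_
  rw [F.invComp_invariantMetric he hy, hpd, hpd, hpd]
  linear_combination (-invComp (F.metric.comp e) a d y *
    (pd c (F.metric.comp e d b) y - pd c (F.scalar ∘ e.symm) y * F.metric.comp e d b y
      + (pd b (F.metric.comp e d c) y - pd b (F.scalar ∘ e.symm) y * F.metric.comp e d c y)
      - (pd d (F.metric.comp e b c) y - pd d (F.scalar ∘ e.symm) y * F.metric.comp e b c y)))
    * hone

/-- The exponents add up: `-(φ + f) + f = -φ`. Equality of the structures themselves allows the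
metric to be rewritten inside every later statement. -/
lemma WeylFrame.transform_invariantMetric (F : WeylFrame M) (f : M → ℝ)
    (hf : ContMDiff (𝓡 4) 𝓘(ℝ, ℝ) ∞ f) :
    (F.transform f hf).invariantMetric = F.invariantMetric := by
  simp only [WeylFrame.invariantMetric, WeylFrame.transform, LorentzMetric.rescale,
    LorentzMetric.mk.injEq]
  funext x
  rw [smul_smul, ← Real.exp_add]
  congr 2
  ring

end Manifold

theorem mainTheorem3 {M : Type*} [TopologicalSpace M] [ChartedSpace Coord M]
    [IsManifold (𝓡 4) ∞ M] (F : WeylFrame M) (U : Set M) (hU : IsOpen U)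
    (V : ∀ x : M, TangentSpace (𝓡 4) x) :
    -- the Raychaudhuri equation for geodesic congruences of the Weyl connection
    (IsGeodesicCongruence F.invariantMetric F.connection U V →
      SatisfiesRaychaudhuri F.invariantMetric F.connection U V) ∧
    -- the Riemannian equation has the same form, and the Weyl equation is the one of `γ`
    (∀ h : LorentzMetric M, IsGeodesicCongruence h h.leviCivita U V →
      SatisfiesRaychaudhuri h h.leviCivita U V) ∧
    (∀ e ∈ IsManifold.maximalAtlas (𝓡 4) ∞ M, ∀ y ∈ e.target, ∀ a b c : Fin 4,
      F.connection e a b c y = F.invariantMetric.leviCivita e a b c y) ∧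
    -- invariance under Weyl transformations
    (∀ (f : M → ℝ) (hf : ContMDiff (𝓡 4) 𝓘(ℝ, ℝ) ∞ f),
      (F.transform f hf).invariantMetric = F.invariantMetric ∧
      (IsGeodesicCongruence (F.transform f hf).invariantMetric (F.transform f hf).connection U V ↔
        IsGeodesicCongruence F.invariantMetric F.connection U V) ∧
      (SatisfiesRaychaudhuri (F.transform f hf).invariantMetric (F.transform f hf).connection U V ↔
        SatisfiesRaychaudhuri F.invariantMetric F.connection U V) ∧
      ∀ e ∈ IsManifold.maximalAtlas (𝓡 4) ∞ M, ∀ y ∈ e.target,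
        (∀ a b c : Fin 4, (F.transform f hf).connection e a b c y = F.connection e a b c y) ∧
        expansion ((F.transform f hf).invariantMetric.comp e) ((F.transform f hf).connection e)
            (vectorComp V e) y =
          expansion (F.invariantMetric.comp e) (F.connection e) (vectorComp V e) y ∧
        (∀ μ ν : Fin 4,
          shear ((F.transform f hf).invariantMetric.comp e) ((F.transform f hf).connection e)
              (vectorComp V e) μ ν y =
            shear (F.invariantMetric.comp e) (F.connection e) (vectorComp V e) μ ν y ∧
          vorticity ((F.transform f hf).invariantMetric.comp e) ((F.transform f hf).connection e)
              (vectorComp V e) μ ν y =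
            vorticity (F.invariantMetric.comp e) (F.connection e) (vectorComp V e) μ ν y ∧
          ricci ((F.transform f hf).connection e) μ ν y = ricci (F.connection e) μ ν y)) := by
  have hLC : ∀ F : WeylFrame M, ∀ e ∈ IsManifold.maximalAtlas (𝓡 4) ∞ M, ∀ y ∈ e.target,
      ∀ a b c, F.connection e a b c y = F.invariantMetric.leviCivita e a b c y :=
    fun F e he y hy ↦ F.connection_eq_leviCivita he hy
  refine ⟨fun hV ↦ ?_, fun h hV ↦ hV.satisfiesRaychaudhuri hU, hLC F, fun f hf ↦ ?_⟩
  -- The congruence is geodesic for the Levi-Civita connection of `γ`; the equation obtained there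
  -- is carried back to the Weyl connection.
  · exact ((hV.congr (hLC F)).satisfiesRaychaudhuri hU).congr
      fun e he y hy a b c ↦ (hLC F e he y hy a b c).symm
  · have hγ := F.transform_invariantMetric f hf
    -- Both Weyl connections are the Levi-Civita connection of the same metric.
    have hC : ∀ e ∈ IsManifold.maximalAtlas (𝓡 4) ∞ M, ∀ y ∈ e.target, ∀ a b c,
        (F.transform f hf).connection e a b c y = F.connection e a b c y :=
      fun e he y hy a b c ↦ by rw [hLC _ e he y hy, hLC F e he y hy, hγ]
    have hC' : ∀ e ∈ IsManifold.maximalAtlas (𝓡 4) ∞ M, ∀ y ∈ e.target, ∀ a b c,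
        F.connection e a b c y = (F.transform f hf).connection e a b c y :=
      fun e he y hy a b c ↦ (hC e he y hy a b c).symm
    rw [hγ]
    exact ⟨rfl, ⟨fun h ↦ h.congr hC, fun h ↦ h.congr hC'⟩,
      ⟨fun h ↦ h.congr hC, fun h ↦ h.congr hC'⟩, fun e he y hy ↦
        ⟨hC e he y hy, expansion_congr (hC e he y hy), fun μ ν ↦
          ⟨shear_congr (hC e he y hy) μ ν, vorticity_congr (hC e he y hy) μ ν,
            ricci_congr (eventuallyEq_of_eqOn_isOpen e.open_target (hC e he) hy) μ ν⟩⟩⟩
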